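/- **Setting.** Let $G=(V,E)$ be a finite directed graph with a source, a target, and positive lazy edge weights $\hat w:E\to\mathbb R_{>0}$. Some edges are in collision; the true weight is $w(e)=\hat w(e)$ if $e$ is not in collision and $w(e)=\infty$ otherwise. Evaluating an edge means computing $w(e)$. Assume that no two distinct simple paths from the source to the same vertex have the same lazy cost (the sum of $\hat w$ over the edges of the path). Let $h^*_G(v)$ be the lazy cost of a shortest path from $v$ to the target in $G$ ($\infty$ if there is none). A heuristic $h:V\to\mathbb R$ is *consistent* if $h(\mathrm{target})=0$ and $h(u)\le \hat w(u,v)+h(v)$ for every edge $(u,v)$. **The algorithm.** LRA\* with lookahead $\alpha\in\{1,2,3,\dots\}\cup\{\infty\}$ and heuristic $h$ maintains the current graph (initially $G$) and a search tree rooted at the source, with at most one node per vertex. The node of $v$ stores its parent, the cost $c$ of the evaluated head and the lazy cost $\ell$ of the unevaluated tail of its tree path, and its budget $b\le\alpha$, the number of edges of that tail. Initially the tree consists of the source, with $c=\ell=b=0$. *Extending the $\alpha$-band* means repeating the following step until it is no longer possible: choose a node $u\ne\mathrm{target}$ of the tree with $b(u)<\alpha$ and an edge $(u,v)$ of the current graph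 such that $v$ is not in the tree or $c(u)+\ell(u)+\hat w(u,v)<c(v)+\ell(v)$; discard the subtree rooted at $v$, if there is one, and insert $v$ as a child of $u$ with entries $c(u)$, $\ell(u)+\hat w(u,v)$, $b(u)+1$. After an initial extension, each iteration proceeds as follows. Among the frontier nodes (the nodes with $b>0$ for which $b=\alpha$ or which belong to the target), pick one with minimal key $c+\ell+h$; if there is no frontier node, stop. Evaluate the first edge $(u,v)$ of the lazy tail of its tree path. * If the edge is collision-free, move it from the tail to the head of the tree paths of $v$ and of all descendants of $v$ (updating $c$, $\ell$, $b$); if $v$ is the target, stop; otherwise extend the $\alpha$-band. * If the edge is in collision, remove it from the current graph, remove the subtree rooted at $v$ from the tree, and extend the $\alpha$-band (this rewires the removed nodes). **Lemma.** Let $h_1,h_2$ be consistent heuristics with $h^*_G(v)\ge h_1(v)>h_2(v)$ for every vertex $v\ne\mathrm{target}$. Then for every lookahead $\alpha$, LRA\* has a complete (finite, halting) run with each of the two heuristics, and whenever $E_i$ is the set of edges evaluated by a complete run of LRA\* with lookahead $\alpha$ and heuristic $h_i$ ($i=1,2$), however ties between keys and the order of the extension steps are resolved, we have $E_1\subseteq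 E_2$. -/

import Mathlib

/-- A lazy shortest-path problem: a directed graph with positive lazy edge estimates `wHat`,
the set of edges that are in collision, a source and a target. -/
structure LazyProblem (V : Type*) where
  graph : Digraph V
  wHat : V → V → ℝ
  wHat_pos : ∀ u v, graph.Adj u v → 0 < wHat u v
  collides : V → V → Prop
  source : V
  target : V

/-- A node entry of the search tree (the vertex is the index of the entry): parent, cost `c` of the
evaluated part of the path, cost `l` of the lazily evaluated part, budget `b` (the number of
lazily evaluated edges). -/
structure TreeNode (V : Type*) where
  parent : Option V
  c : ℝ
  l : ℝ
  b : ℕ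

/-- The estimated cost-to-come `c + l`. -/
def TreeNode.cost {V : Type*} (n : TreeNode V) : ℝ := n.c + n.l

/-- A search tree holds at most one node per vertex. -/
abbrev SearchTree (V : Type*) := V → Option (TreeNode V)

namespace SearchTree

variable {V : Type*}

/-- The node of `v` is a child of the node of `u`. -/
def IsChild (T : SearchTree V) (u v : V) : Prop :=
  ∃ n, T v = some n ∧ n.parent = some u

/-- The node of `x` lies in the subtree rooted at the node of `v` (which includes `v`). -/
def InSubtree (T : SearchTree V) (v x : V) : Prop :=
  Relation.ReflTransGen T.IsChild v x

open Classical in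
/-- Remove the subtree rooted at `v`. -/
noncomputable def removeSubtree (T : SearchTree V) (v : V) : SearchTree V :=
  fun x => if T.InSubtree v x then none else T x

open Classical in
/-- Insert (or overwrite) the node of `v`. -/
noncomputable def insertNode (T : SearchTree V) (v : V) (n : TreeNode V) : SearchTree V :=
  fun x => if x = v then some n else T x

open Classical in
/-- Update after the edge into `v`, of cost `r`, was found to be collision-free: on the path of
`v` and of each of its descendants this edge moves from the lazy part to the evaluated part. -/
noncomputable def updateSubtree (T : SearchTree V) (v : V) (r : ℝ) : SearchTree V :=
  fun x => if T.InSubtree v x then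
    (T x).map (fun n => ⟨n.parent, n.c + r, n.l - r, n.b - 1⟩) else T x

end SearchTree

namespace LazyProblem

variable {V : Type*} (P : LazyProblem V)

open Classical in
/-- The true cost of an edge: the lazy estimate, or `∞` if the edge is in collision. -/
noncomputable def w (u v : V) : EReal := if P.collides u v then ⊤ else (P.wHat u v : EReal)

/-- A path from `u` to `v`: a sequence of vertices in which consecutive ones are joined by edges. -/
def IsPath (p : List V) (u v : V) : Prop :=
  p.IsChain P.graph.Adj ∧ p.head? = some u ∧ p.getLast? = some v

/-- The lazy cost of a path. -/
def lazyCost : List V → ℝ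
  | [] => 0
  | [_] => 0
  | u :: v :: p => P.wHat u v + lazyCost (v :: p)

/-- No two distinct simple paths from the source to the same vertex have the same lazy cost. -/
def NoTies : Prop :=
  ∀ (v : V) (p q : List V), P.IsPath p P.source v → P.IsPath q P.source v →
    p.Nodup → q.Nodup → P.lazyCost p = P.lazyCost q → p = q

/-- The optimal heuristic: the length of the shortest path in the graph from `v` to the target
(`∞` if there is no such path). -/
noncomputable def optHeuristic (v : V) : EReal :=
  ⨅ (p : List V) (_ : P.IsPath p v P.target), (P.lazyCost p : EReal)

/-- Consistency of a heuristic. -/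
def Consistent (h : V → ℝ) : Prop :=
  h P.target = 0 ∧ ∀ u v, P.graph.Adj u v → h u ≤ P.wHat u v + h v

/-- The edges of the input graph. -/
def edgeSet : Set (V × V) := {e | P.graph.Adj e.1 e.2}

/-- The node `u ↦ m` may be used to improve the path to `v`: it has budget smaller than `α`, it is
not the target, `(u, v)` is an edge of the current graph, and either `v` has no node in the tree,
or the path through `u` is cheaper than its current one. -/
def CanRelax (α : ℕ∞) (E : Set (V × V)) (T : SearchTree V) (u v : V) (m : TreeNode V) : Prop :=
  T u = some m ∧ (m.b : ℕ∞) < α ∧ u ≠ P.target ∧ (u, v) ∈ E ∧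
    ∀ n, T v = some n → m.cost + P.wHat u v < n.cost

/-- One elementary rewiring or extension of the band: the old subtree of `v`, if any, is discarded
and `v` becomes a child of `u`, with a lazily evaluated edge. -/
inductive Relax (α : ℕ∞) (E : Set (V × V)) : SearchTree V → SearchTree V → Prop
  | mk (T : SearchTree V) (u v : V) (m : TreeNode V) (hr : P.CanRelax α E T u v m) :
      Relax α E T
        ((T.removeSubtree v).insertNode v ⟨some u, m.c, m.l + P.wHat u v, m.b + 1⟩)

/-- Rewiring and extending the `α`-band: elementary steps are made until none is left, so that
every remaining leaf is a frontier node and every node has its best parent. -/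
def ExtendsTo (α : ℕ∞) (E : Set (V × V)) (T T' : SearchTree V) : Prop :=
  Relation.ReflTransGen (P.Relax α E) T T' ∧ ∀ u v m, ¬ P.CanRelax α E T' u v m

/-- The members of the frontier queue: the nodes of the band (positive budget) that have budget
`α` or belong to the target, which is never extended. -/
def IsFrontier (α : ℕ∞) (T : SearchTree V) (x : V) (n : TreeNode V) : Prop :=
  T x = some n ∧ 0 < n.b ∧ ((n.b : ℕ∞) = α ∨ x = P.target)

/-- The node of `x` may be popped: it is a frontier node with minimal key `c + l + h`. -/
def IsPopped (α : ℕ∞) (h : V → ℝ) (T : SearchTree V) (x : V) : Prop :=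
  ∃ n, P.IsFrontier α T x n ∧
    ∀ y n', P.IsFrontier α T y n' → n.cost + h x ≤ n'.cost + h y

/-- `(u, v)` is the first edge of the lazily evaluated tail of the tree path to `x`. -/
def IsFirstLazyEdge (T : SearchTree V) (x u v : V) : Prop :=
  T.InSubtree v x ∧ ∃ n, T v = some n ∧ n.parent = some u ∧ n.b = 1

/-- A state of the algorithm at the beginning of an iteration: the remaining edges of the graph,
the search tree, the edges evaluated so far, and whether a path to the target was returned. -/
structure State (V : Type*) where
  edges : Set (V × V)
  tree : SearchTree V
  evaluated : Set (V × V)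
  found : Prop

/-- One iteration of LRA* with lookahead `α` and heuristic `h`. -/
inductive Step (α : ℕ∞) (h : V → ℝ) : State V → State V → Prop
  /-- The evaluated edge is collision-free and leads to the target: stop. -/
  | reach (s : State V) (x u v : V) (hs : ¬ s.found)
      (hx : P.IsPopped α h s.tree x) (he : IsFirstLazyEdge s.tree x u v)
      (hw : P.w u v = (P.wHat u v : EReal)) (hv : v = P.target) :
      Step α h s
        ⟨s.edges, s.tree.updateSubtree v (P.wHat u v), insert (u, v) s.evaluated, True⟩
  /-- The evaluated edge is collision-free: update the subtree and extend the band. -/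
  | free (s : State V) (x u v : V) (T' : SearchTree V) (hs : ¬ s.found)
      (hx : P.IsPopped α h s.tree x) (he : IsFirstLazyEdge s.tree x u v)
      (hw : P.w u v = (P.wHat u v : EReal)) (hv : v ≠ P.target)
      (hT : P.ExtendsTo α s.edges (s.tree.updateSubtree v (P.wHat u v)) T') :
      Step α h s ⟨s.edges, T', insert (u, v) s.evaluated, False⟩
  /-- The evaluated edge is in collision: remove it, take the subtree below it off the tree,
  rewire and extend the band. -/
  | collision (s : State V) (x u v : V) (T' : SearchTree V) (hs : ¬ s.found)
      (hx : P.IsPopped α h s.tree x) (he : IsFirstLazyEdge s.tree x u v)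
      (hw : P.w u v ≠ (P.wHat u v : EReal))
      (hT : P.ExtendsTo α (s.edges \ {(u, v)}) (s.tree.removeSubtree v) T') :
      Step α h s ⟨s.edges \ {(u, v)}, T', insert (u, v) s.evaluated, False⟩

open Classical in
/-- The tree that consists of the source only. -/
noncomputable def rootTree : SearchTree V :=
  fun x => if x = P.source then some ⟨none, 0, 0, 0⟩ else none

/-- An initial state: the band has been extended from the source, nothing has been evaluated. -/
def IsInitial (α : ℕ∞) (s : State V) : Prop :=
  s.edges = P.edgeSet ∧ P.ExtendsTo α P.edgeSet P.rootTree s.tree ∧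
    s.evaluated = ∅ ∧ ¬ s.found

/-- The algorithm has stopped: a path was returned, or the frontier queue is empty. -/
def IsHalted (α : ℕ∞) (s : State V) : Prop :=
  s.found ∨ ∀ x n, ¬ P.IsFrontier α s.tree x n

/-- `E` is the set of edges evaluated by a complete run of LRA* with lookahead `α` and
heuristic `h`. -/
def IsEvaluatedSet (α : ℕ∞) (h : V → ℝ) (E : Set (V × V)) : Prop :=
  ∃ s₀ s, P.IsInitial α s₀ ∧ Relation.ReflTransGen (P.Step α h) s₀ s ∧ P.IsHalted α s ∧
    s.evaluated = E

end LazyProblem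

/-!
By consistency keys do not decrease along walks, so the minimal key at any moment is a lower bound
for the cost of every walk from the source to the target that is still possible, and the tree path
to every vertex below which a node is popped is a cheapest one. Suppose that a complete run with
`h₂` never evaluates the edge `(u, v)` which a run with `h₁` evaluates, and take the first such
edge; it belongs to the lazy tail of the path to a popped node `x`. All edges up to `u` have been
evaluated in both runs. The final tree of the second run is closed under extension, and cheapest
simple paths are unique, so it contains the path to `x` with the same lazy tail: no later edge of
the tail can have been evaluated before `(u, v)`. Hence `x` is a frontier node of the second run,
which therefore has halted with a path to the target of cost at most `c + ℓ + h₂ x`. But the first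
run popped `x`, so every path to the target costs at least `c + ℓ + h₁ x > c + ℓ + h₂ x`.

Runs terminate because every iteration settles a vertex or deletes an edge.
-/

/-! ## Walks from the source -/

namespace LazyProblem

variable {V : Type*} {P : LazyProblem V}

/-- There is a walk of lazy cost `r` from the source to `v` all of whose edges lie in `E`. Keeping
the cost instead of the list of vertices lets walks be extended edge by edge. -/
inductive Reaches (P : LazyProblem V) (E : Set (V × V)) : V → ℝ → Prop
  | source : Reaches P E P.source 0
  | step {u v : V} {r : ℝ} : Reaches P E u r → (u, v) ∈ E → Reaches P E v (r + P.wHat u v)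

/-- The lazy distance from the source to `v` in the graph with edge set `E` is attained and equal
to `r`. -/
def IsCheapest (P : LazyProblem V) (E : Set (V × V)) (v : V) (r : ℝ) : Prop :=
  IsLeast {r | P.Reaches E v r} r

/-- `p` is a simple path from the source to `v` of lazy cost `r`, each vertex of which is reached
in `E` at cost at most `r`. The last clause is what keeps the path simple when an edge to a more
distant vertex is appended. -/
structure IsSimpleWalk (P : LazyProblem V) (E : Set (V × V)) (p : List V) (v : V) (r : ℝ) :
    Prop where
  isPath : P.IsPath p P.source v
  nodup : p.Nodup
  lazyCost_eq : P.lazyCost p = r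
  reaches_le : ∀ x ∈ p, ∃ r' ≤ r, P.Reaches E x r'

section Walks

variable {E F : Set (V × V)} {u v : V} {r : ℝ}

lemma Reaches.mono (hEF : E ⊆ F) (hr : P.Reaches E v r) : P.Reaches F v r := by
  induction hr with
  | source => exact .source
  | step _ he ih => exact .step ih (hEF he)

lemma Reaches.nonneg (hE : E ⊆ P.edgeSet) (hr : P.Reaches E v r) : 0 ≤ r := by
  induction hr with
  | source => exact le_rfl
  | step _ he ih => exact add_nonneg ih (P.wHat_pos _ _ (hE he)).le

lemma IsCheapest.of_step (hv : P.IsCheapest E v (r + P.wHat u v)) (hu : P.Reaches E u r)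
    (he : (u, v) ∈ E) : P.IsCheapest E u r :=
  ⟨hu, fun _ hr' => le_of_add_le_add_right (hv.2 (Reaches.step hr' he))⟩

lemma lazyCost_concat {p : List V} (hp : p.getLast? = some u) (v : V) :
    P.lazyCost (p ++ [v]) = P.lazyCost p + P.wHat u v := by
  induction p with
  | nil => simp at hp
  | cons a p ih =>
    cases p with
    | nil =>
      obtain rfl : a = u := by simpa using hp
      simp [lazyCost]
    | cons b p =>
      have ih := ih (by simpa using hp)
      simp only [List.cons_append, lazyCost] at ih ⊢
      rw [ih, add_assoc]

lemma IsPath.concat {p : List V} {s : V} (hp : P.IsPath p s u) (h : P.graph.Adj u v) :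
    P.IsPath (p ++ [v]) s v := by
  obtain ⟨hchain, hhead, hlast⟩ := hp
  exact ⟨List.isChain_append.2 ⟨hchain, by simp, by simpa [hlast] using h⟩,
    by simp [List.head?_append, hhead], by simp⟩

lemma IsSimpleWalk.concat {p : List V} (hp : P.IsSimpleWalk E p u r) (hE : E ⊆ P.edgeSet)
    (he : (u, v) ∈ E) (hv : P.IsCheapest E v (r + P.wHat u v)) :
    P.IsSimpleWalk E (p ++ [v]) v (r + P.wHat u v) := by
  have hpos := P.wHat_pos u v (hE he)
  have hvp : v ∉ p := fun hmem => by
    obtain ⟨r', hle, hr'⟩ := hp.reaches_le v hmem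
    have := hv.2 hr'
    linarith
  refine ⟨hp.isPath.concat (hE he), by simpa using (List.nodup_concat p v).2 ⟨hvp, hp.nodup⟩,
    by rw [lazyCost_concat hp.isPath.2.2, hp.lazyCost_eq], fun x hx => ?_⟩
  rcases List.mem_append.1 hx with hx | hx
  · obtain ⟨r', hle, hr'⟩ := hp.reaches_le x hx
    exact ⟨r', by linarith, hr'⟩
  · obtain rfl : x = v := by simpa using hx
    exact ⟨_, le_rfl, hv.1⟩

lemma IsCheapest.exists_isSimpleWalk (hE : E ⊆ P.edgeSet) (hv : P.IsCheapest E v r) :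
    ∃ p, P.IsSimpleWalk E p v r := by
  have hr : P.Reaches E v r := hv.1
  induction hr with
  | source =>
    exact ⟨[P.source], ⟨by simp, by simp, by simp⟩, by simp, rfl, by simpa using ⟨0, le_rfl, hv.1⟩⟩
  | step hu he ih =>
    obtain ⟨p, hp⟩ := ih (hv.of_step hu he)
    exact ⟨_, hp.concat hE he hv⟩

lemma NoTies.eq_of_isCheapest (hties : P.NoTies) (hE : E ⊆ P.edgeSet) {u' : V} {r' : ℝ}
    (hu : P.Reaches E u r) (hu' : P.Reaches E u' r') (he : (u, v) ∈ E) (he' : (u', v) ∈ E)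
    (hv : P.IsCheapest E v (r + P.wHat u v)) (hv' : P.IsCheapest E v (r' + P.wHat u' v)) :
    u = u' := by
  obtain ⟨p, hp⟩ := (hv.of_step hu he).exists_isSimpleWalk hE
  obtain ⟨q, hq⟩ := (hv'.of_step hu' he').exists_isSimpleWalk hE
  have hpv := hp.concat hE he hv
  have hqv := hq.concat hE he' hv'
  have hpq : p ++ [v] = q ++ [v] := hties v _ _ hpv.isPath hqv.isPath hpv.nodup hqv.nodup
    (by rw [hpv.lazyCost_eq, hqv.lazyCost_eq, hv.unique hv'])
  obtain rfl := List.append_cancel_right hpq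
  exact Option.some_injective _ (hp.isPath.2.2.symm.trans hq.isPath.2.2)

end Walks

end LazyProblem

/-! ## Operations on search trees -/

namespace SearchTree

variable {V : Type*} {T T' : SearchTree V} {u v w x : V} {m n : TreeNode V}

/-- The vertex `v` has a node with empty lazy tail: its tree path has been evaluated. -/
def Settled (T : SearchTree V) (v : V) : Prop := ∃ n, T v = some n ∧ n.b = 0

/-- The edges that join the nodes of `T` to their children. -/
def childEdges (T : SearchTree V) : Set (V × V) := {e | T.IsChild e.1 e.2}

/-- The vertices whose node has estimated cost `r`. -/
def costLevel (T : SearchTree V) (r : ℝ) : Set V := {x | ∃ n, T x = some n ∧ n.cost = r}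

/-- The nodes of `x` in the two trees have the same cost and the same budget. The split of the cost
into head and tail is ignored. -/
def AgreeAt (T T' : SearchTree V) (x : V) : Prop :=
  ∃ n n', T x = some n ∧ T' x = some n' ∧ n'.cost = n.cost ∧ n'.b = n.b

open Classical in
/-- The node that replaces the node `n` of `x` in `T.updateSubtree v r`. -/
noncomputable def updatedNode (T : SearchTree V) (v : V) (r : ℝ) (x : V) (n : TreeNode V) :
    TreeNode V :=
  if T.InSubtree v x then ⟨n.parent, n.c + r, n.l - r, n.b - 1⟩ else n

lemma settled_iff (hn : T v = some n) : T.Settled v ↔ n.b = 0 := by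
  simp [Settled, hn]

lemma inSubtree_iff_of_parent (hn : T x = some n) (hp : n.parent = some u) :
    T.InSubtree v x ↔ x = v ∨ T.InSubtree v u := by
  constructor
  · intro h
    rcases Relation.ReflTransGen.cases_tail h with h | ⟨y, hvy, k, hk, hky⟩
    · exact .inl h
    · obtain rfl : n = k := by simpa [hn] using hk
      obtain rfl : u = y := by simpa [hp] using hky
      exact .inr hvy
  · rintro (rfl | h)
    exacts [.refl, h.tail ⟨n, hn, hp⟩]

lemma InSubtree.congr (hT : ∀ x, ¬ T.InSubtree v x → T' x = T x) (hwx : T.InSubtree w x)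
    (hvx : ¬ T.InSubtree v x) : T'.InSubtree w x := by
  induction hwx with
  | refl => exact .refl
  | tail _ hyz ih =>
    obtain ⟨n, hn, hp⟩ := id hyz
    exact (ih fun hvy => hvx (hvy.tail hyz)).tail ⟨n, by rw [hT _ hvx, hn], hp⟩

lemma removeSubtree_of_not_inSubtree (hx : ¬ T.InSubtree v x) : T.removeSubtree v x = T x :=
  if_neg hx

lemma removeSubtree_eq_some_iff :
    T.removeSubtree v x = some n ↔ T x = some n ∧ ¬ T.InSubtree v x := by
  by_cases h : T.InSubtree v x <;> simp [removeSubtree, h]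

lemma updateSubtree_apply (T : SearchTree V) (v : V) (r : ℝ) (x : V) :
    T.updateSubtree v r x = (T x).map (T.updatedNode v r x) := by
  by_cases h : T.InSubtree v x <;> cases hx : T x <;> simp [updateSubtree, updatedNode, h, hx]

lemma updateSubtree_of_eq_some (r : ℝ) (hn : T x = some n) :
    T.updateSubtree v r x = some (T.updatedNode v r x n) := by
  rw [updateSubtree_apply, hn, Option.map_some]

lemma updateSubtree_eq_some_iff {r : ℝ} :
    T.updateSubtree v r x = some n ↔ ∃ k, T x = some k ∧ T.updatedNode v r x k = n := by
  rw [updateSubtree_apply, Option.map_eq_some_iff]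

lemma updatedNode_parent (r : ℝ) : (T.updatedNode v r x n).parent = n.parent := by
  unfold updatedNode; split_ifs <;> rfl

lemma updatedNode_cost (r : ℝ) : (T.updatedNode v r x n).cost = n.cost := by
  unfold updatedNode
  split_ifs
  · simp only [TreeNode.cost]; ring
  · rfl

lemma updatedNode_b_of_inSubtree (r : ℝ) (hx : T.InSubtree v x) :
    (T.updatedNode v r x n).b = n.b - 1 := by
  rw [updatedNode, if_pos hx]

lemma updatedNode_of_not_inSubtree (r : ℝ) (hx : ¬ T.InSubtree v x) :
    T.updatedNode v r x n = n :=
  if_neg hx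

lemma updatedNode_b_le (r : ℝ) : (T.updatedNode v r x n).b ≤ n.b := by
  unfold updatedNode
  split_ifs
  exacts [Nat.sub_le _ _, le_rfl]

lemma isChild_updateSubtree (r : ℝ) : (T.updateSubtree v r).IsChild = T.IsChild := by
  ext u x
  simp only [IsChild, updateSubtree_eq_some_iff]
  constructor
  · rintro ⟨_, ⟨k, hk, rfl⟩, hp⟩
    exact ⟨k, hk, (updatedNode_parent r).symm.trans hp⟩
  · rintro ⟨k, hk, hp⟩
    exact ⟨_, ⟨k, hk, rfl⟩, (updatedNode_parent r).trans hp⟩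

end SearchTree

/-! ## The invariant of the search tree -/

namespace LazyProblem

variable {V : Type*} {P : LazyProblem V} {α : ℕ∞} {E F : Set (V × V)} {T : SearchTree V}
  {u v x : V} {m n : TreeNode V}

/-- The relation between the nodes `m` of `u` and `n` of `v` if `v` is a child of `u` in a search
tree of the graph with edge set `E`, where `F` is the set of evaluated edges: the edge `(u, v)`
belongs to the lazy tail of `v`, or the tree path to `v` has been evaluated entirely. -/
structure IsLink (P : LazyProblem V) (E F : Set (V × V)) (u : V) (m : TreeNode V) (v : V)
    (n : TreeNode V) : Prop where
  mem : (u, v) ∈ E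
  ne_target : u ≠ P.target
  cost_eq : n.cost = m.cost + P.wHat u v
  budget : n.b = m.b + 1 ∨ n.b = 0 ∧ m.b = 0 ∧ (u, v) ∈ F ∧ ¬ P.collides u v

lemma IsLink.mono (h : P.IsLink E F u m v n) {E' F' : Set (V × V)} (hE : (u, v) ∈ E')
    (hF : F ⊆ F') : P.IsLink E' F' u m v n :=
  ⟨hE, h.ne_target, h.cost_eq, h.budget.imp_right fun ⟨hn, hm, hf, hc⟩ => ⟨hn, hm, hF hf, hc⟩⟩

/-- The invariant of the search tree with respect to the edge set `E` of the current graph and the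
set `F` of evaluated edges. -/
structure IsSearchTree (P : LazyProblem V) (α : ℕ∞) (E F : Set (V × V)) (T : SearchTree V) :
    Prop where
  edges_subset : E ⊆ P.edgeSet
  root : ∃ n, T P.source = some n ∧ n.cost = 0 ∧ n.b = 0
  rooted : ∀ v n, T v = some n → T.InSubtree P.source v
  link : ∀ u v n, T v = some n → n.parent = some u → ∃ m, T u = some m ∧ P.IsLink E F u m v n
  band : ∀ v n, T v = some n → (n.b : ℕ∞) ≤ α
  settled : ∀ v n, T v = some n → n.b = 0 → ∀ r, P.Reaches E v r → n.cost ≤ r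

lemma consistent_zero (P : LazyProblem V) : P.Consistent fun _ => 0 :=
  ⟨rfl, fun u v h => by simpa using (P.wHat_pos u v h).le⟩

namespace IsSearchTree

lemma wHat_pos (hT : P.IsSearchTree α E F T) (he : (u, v) ∈ E) : 0 < P.wHat u v :=
  P.wHat_pos u v (hT.edges_subset he)

lemma exists_of_isChild (hT : P.IsSearchTree α E F T) (h : T.IsChild u v) (hn : T v = some n) :
    n.parent = some u ∧ ∃ m, T u = some m ∧ P.IsLink E F u m v n := by
  obtain ⟨n', hn', hp⟩ := h
  obtain rfl : n = n' := by simpa [hn] using hn'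
  exact ⟨hp, hT.link u v n hn hp⟩

lemma exists_parent (hT : P.IsSearchTree α E F T) (hn : T v = some n) (hv : v ≠ P.source) :
    ∃ u m, n.parent = some u ∧ T u = some m ∧ P.IsLink E F u m v n := by
  rcases Relation.ReflTransGen.cases_tail (hT.rooted v n hn) with h | ⟨u, -, h⟩
  · exact absurd h hv
  · obtain ⟨hp, m, hm, hl⟩ := hT.exists_of_isChild h hn
    exact ⟨u, m, hp, hm, hl⟩

lemma induction (hT : P.IsSearchTree α E F T) {p : V → TreeNode V → Prop}
    (root : ∀ n, T P.source = some n → n.cost = 0 → n.b = 0 → p P.source n)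
    (step : ∀ u m v n, T u = some m → T v = some n → n.parent = some u → P.IsLink E F u m v n →
      p u m → p v n)
    (hn : T v = some n) : p v n := by
  have hv := hT.rooted v n hn
  induction hv generalizing n with
  | refl =>
    obtain ⟨k, hk, hcost, hb⟩ := hT.root
    obtain rfl : n = k := by simpa [hn] using hk
    exact root n hn hcost hb
  | tail _ hyz ih =>
    obtain ⟨hp, m, hm, hl⟩ := hT.exists_of_isChild hyz hn
    exact step _ m _ n hm hn hp hl (ih hm)

lemma cost_nonneg (hT : P.IsSearchTree α E F T) (hn : T v = some n) : 0 ≤ n.cost := by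
  refine hT.induction (p := fun _ n => 0 ≤ n.cost) (fun n _ hcost _ => hcost.ge) ?_ hn
  intro u m v n _ _ _ hl ih
  rw [hl.cost_eq]
  exact add_nonneg ih (hT.wHat_pos hl.mem).le

lemma ne_source_of_cost_pos (hT : P.IsSearchTree α E F T) (hn : T v = some n)
    (hpos : 0 < n.cost) : v ≠ P.source := by
  rintro rfl
  obtain ⟨k, hk, hcost, -⟩ := hT.root
  obtain rfl : n = k := by simpa [hn] using hk
  exact hpos.ne' hcost

lemma childEdges_subset (hT : P.IsSearchTree α E F T) : T.childEdges ⊆ E := by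
  rintro ⟨u, v⟩ ⟨n, hn, hp⟩
  obtain ⟨m, -, hl⟩ := hT.link u v n hn hp
  exact hl.mem

lemma isCheapest_childEdges (hT : P.IsSearchTree α E F T) (hn : T v = some n) :
    P.IsCheapest T.childEdges v n.cost := by
  constructor
  · refine hT.induction (p := fun v n => P.Reaches T.childEdges v n.cost) ?_ ?_ hn
    · exact fun n _ hcost _ => hcost ▸ .source
    · intro u m v n _ hn hp hl ih
      exact hl.cost_eq ▸ ih.step ⟨n, hn, hp⟩
  · intro r hr
    have hr : P.Reaches T.childEdges v r := hr
    induction hr generalizing n with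
    | source =>
      obtain ⟨k, hk, hcost, -⟩ := hT.root
      obtain rfl : n = k := by simpa [hn] using hk
      exact hcost.le
    | step _ he ih =>
      obtain ⟨-, m, hm, hl⟩ := hT.exists_of_isChild he hn
      rw [hl.cost_eq]
      exact add_le_add_left (ih hm ‹_›) _

lemma reaches (hT : P.IsSearchTree α E F T) (hn : T v = some n) : P.Reaches E v n.cost :=
  (hT.isCheapest_childEdges hn).1.mono hT.childEdges_subset

lemma exists_nodup_lazyCost_eq (hT : P.IsSearchTree α E F T) (hn : T v = some n) :
    ∃ p : List V, p.Nodup ∧ P.lazyCost p = n.cost := by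
  obtain ⟨p, hp⟩ := (hT.isCheapest_childEdges hn).exists_isSimpleWalk
    (hT.childEdges_subset.trans hT.edges_subset)
  exact ⟨p, hp.nodup, hp.lazyCost_eq⟩

lemma exists_of_inSubtree (hT : P.IsSearchTree α E F T) (hvx : T.InSubtree v x)
    (hn : T x = some n) : ∃ m, T v = some m := by
  rcases Relation.ReflTransGen.cases_head hvx with rfl | ⟨y, ⟨k, hk, hp⟩, -⟩
  · exact ⟨n, hn⟩
  · obtain ⟨m, hm, -⟩ := hT.link v y k hk hp
    exact ⟨m, hm⟩

lemma key_le_of_inSubtree (hT : P.IsSearchTree α E F T) {h : V → ℝ} (hc : P.Consistent h)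
    (hvx : T.InSubtree v x) (hm : T v = some m) (hn : T x = some n) :
    m.cost + h v ≤ n.cost + h x := by
  induction hvx generalizing n with
  | refl =>
    obtain rfl : m = n := by simpa [hm] using hn
    exact le_rfl
  | tail _ hyz ih =>
    obtain ⟨-, k, hk, hl⟩ := hT.exists_of_isChild hyz hn
    have := hc.2 _ _ (hT.edges_subset hl.mem)
    have := ih hk
    have := hl.cost_eq
    linarith

lemma cost_le_of_inSubtree (hT : P.IsSearchTree α E F T) (hvx : T.InSubtree v x)
    (hm : T v = some m) (hn : T x = some n) : m.cost ≤ n.cost := by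
  simpa using hT.key_le_of_inSubtree P.consistent_zero hvx hm hn

lemma budget_le_of_inSubtree (hT : P.IsSearchTree α E F T) (hvx : T.InSubtree v x)
    (hm : T v = some m) (hn : T x = some n) : m.b ≤ n.b := by
  induction hvx generalizing n with
  | refl =>
    obtain rfl : m = n := by simpa [hm] using hn
    exact le_rfl
  | tail _ hyz ih =>
    obtain ⟨-, k, hk, hl⟩ := hT.exists_of_isChild hyz hn
    have := ih hk
    have := hl.budget
    omega

lemma budget_lt_of_inSubtree (hT : P.IsSearchTree α E F T) (hvx : T.InSubtree v x)
    (hm : T v = some m) (hn : T x = some n) (hne : x ≠ v) (hb : 0 < n.b) : m.b < n.b := by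
  rcases Relation.ReflTransGen.cases_tail hvx with h | ⟨y, hvy, hyx⟩
  · exact absurd h hne
  · obtain ⟨-, k, hk, hl⟩ := hT.exists_of_isChild hyx hn
    have := hT.budget_le_of_inSubtree hvy hm hk
    have := hl.budget
    omega

lemma eq_of_inSubtree_target (hT : P.IsSearchTree α E F T) (h : T.InSubtree P.target x) :
    x = P.target := by
  rcases Relation.ReflTransGen.cases_head h with h | ⟨y, ⟨k, hk, hp⟩, -⟩
  · exact h.symm
  · obtain ⟨m, -, hl⟩ := hT.link _ _ _ hk hp
    exact absurd rfl hl.ne_target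

lemma not_inSubtree_of_settled (hT : P.IsSearchTree α E F T) (hm : T v = some m) (hb : 0 < m.b)
    (hx : T.Settled x) : ¬ T.InSubtree v x := by
  obtain ⟨n, hn, hn0⟩ := hx
  intro hvx
  have := hT.budget_le_of_inSubtree hvx hm hn
  omega

end IsSearchTree

/-! ## Extension of the band -/

/-- The node that an extension step along the edge `(u, v)` gives to `v`, where `m` is the node
of `u`. -/
def childNode (P : LazyProblem V) (u v : V) (m : TreeNode V) : TreeNode V :=
  ⟨some u, m.c, m.l + P.wHat u v, m.b + 1⟩

/-- The tree after an extension step along the edge `(u, v)`. -/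
noncomputable def relaxed (P : LazyProblem V) (T : SearchTree V) (u v : V) (m : TreeNode V) :
    SearchTree V :=
  (T.removeSubtree v).insertNode v (P.childNode u v m)

lemma cost_childNode : (P.childNode u v m).cost = m.cost + P.wHat u v :=
  (add_assoc _ _ _).symm

lemma relaxed_self : P.relaxed T u v m v = some (P.childNode u v m) :=
  if_pos rfl

lemma relaxed_of_ne (hx : x ≠ v) : P.relaxed T u v m x = T.removeSubtree v x :=
  if_neg hx

lemma relaxed_of_not_inSubtree (hx : ¬ T.InSubtree v x) : P.relaxed T u v m x = T x := by
  rw [relaxed_of_ne (by rintro rfl; exact hx .refl), SearchTree.removeSubtree_of_not_inSubtree hx]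

lemma relaxed_eq_some_iff_of_ne (hx : x ≠ v) :
    P.relaxed T u v m x = some n ↔ T x = some n ∧ ¬ T.InSubtree v x := by
  rw [relaxed_of_ne hx, SearchTree.removeSubtree_eq_some_iff]

lemma exists_le_of_not_canRelax (hcl : ¬ P.CanRelax α E T u v m) (hm : T u = some m)
    (hb : (m.b : ℕ∞) < α) (hu : u ≠ P.target) (he : (u, v) ∈ E) :
    ∃ n, T v = some n ∧ n.cost ≤ m.cost + P.wHat u v := by
  by_contra! h
  exact hcl ⟨hm, hb, hu, he, h⟩

namespace IsSearchTree

section Relaxation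

variable (hT : P.IsSearchTree α E F T) (hr : P.CanRelax α E T u v m)
include hT hr

lemma lt_cost_of_inSubtree (hx : T.InSubtree v x) (hn : T x = some n) :
    m.cost + P.wHat u v < n.cost := by
  obtain ⟨k, hk⟩ := hT.exists_of_inSubtree hx hn
  exact (hr.2.2.2.2 k hk).trans_le (hT.cost_le_of_inSubtree hx hk hn)

lemma not_inSubtree_of_canRelax : ¬ T.InSubtree v u := fun h =>
  (hT.lt_cost_of_inSubtree hr h hr.1).not_ge (le_add_of_nonneg_right (hT.wHat_pos hr.2.2.2.1).le)

lemma not_inSubtree_of_canRelax_of_settled (hx : T.Settled x) : ¬ T.InSubtree v x := by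
  intro hvx
  obtain ⟨n, hn, hb⟩ := hx
  obtain ⟨k, hk⟩ := hT.exists_of_inSubtree hvx hn
  have hk0 : k.b = 0 := Nat.le_zero.1 (hb ▸ hT.budget_le_of_inSubtree hvx hk hn)
  exact (hr.2.2.2.2 k hk).not_ge (hT.settled v k hk hk0 _ (.step (hT.reaches hr.1) hr.2.2.2.1))

lemma relaxed_eq_some_iff_of_budget_eq_zero (hb : n.b = 0) :
    P.relaxed T u v m x = some n ↔ T x = some n := by
  constructor
  · intro hn
    have hx : x ≠ v := by
      rintro rfl
      rw [relaxed_self, Option.some_inj] at hn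
      simp [← hn, childNode] at hb
    exact ((relaxed_eq_some_iff_of_ne hx).1 hn).1
  · intro hn
    rwa [relaxed_of_not_inSubtree (hT.not_inSubtree_of_canRelax_of_settled hr ⟨n, hn, hb⟩)]

lemma inSubtree_source_relaxed (hn : P.relaxed T u v m x = some n) :
    (P.relaxed T u v m).InSubtree P.source x := by
  have of_not {y k} (hk : T y = some k) (hy : ¬ T.InSubtree v y) :
      (P.relaxed T u v m).InSubtree P.source y :=
    (hT.rooted y k hk).congr (fun _ => relaxed_of_not_inSubtree) hy
  by_cases hx : x = v
  · subst hx
    exact (of_not hr.1 (hT.not_inSubtree_of_canRelax hr)).tail ⟨_, relaxed_self, rfl⟩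
  · obtain ⟨hk, hvx⟩ := (relaxed_eq_some_iff_of_ne hx).1 hn
    exact of_not hk hvx

lemma link_relaxed {y : V} (hn : P.relaxed T u v m x = some n) (hp : n.parent = some y) :
    ∃ k, P.relaxed T u v m y = some k ∧ P.IsLink E F y k x n := by
  by_cases hx : x = v
  · subst hx
    obtain rfl : P.childNode u x m = n := by simpa [relaxed_self] using hn
    obtain rfl : u = y := by simpa [childNode] using hp
    exact ⟨m, by rw [relaxed_of_not_inSubtree (hT.not_inSubtree_of_canRelax hr), hr.1],
      hr.2.2.2.1, hr.2.2.1, cost_childNode, .inl rfl⟩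
  · obtain ⟨hn', hvx⟩ := (relaxed_eq_some_iff_of_ne hx).1 hn
    obtain ⟨k, hk, hl⟩ := hT.link y x n hn' hp
    have hvy : ¬ T.InSubtree v y := fun h => hvx (h.tail ⟨n, hn', hp⟩)
    exact ⟨k, by rw [relaxed_of_not_inSubtree hvy, hk], hl⟩

lemma relaxed : P.IsSearchTree α E F (P.relaxed T u v m) where
  edges_subset := hT.edges_subset
  root := by
    obtain ⟨n, hn, hcost, hb⟩ := hT.root
    exact ⟨n, (hT.relaxed_eq_some_iff_of_budget_eq_zero hr hb).2 hn, hcost, hb⟩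
  rooted _ _ := hT.inSubtree_source_relaxed hr
  link _ _ _ := hT.link_relaxed hr
  band x n hn := by
    by_cases hx : x = v
    · subst hx
      obtain rfl : P.childNode u x m = n := by simpa [relaxed_self] using hn
      exact_mod_cast Order.add_one_le_of_lt hr.2.1
    · exact hT.band x n ((relaxed_eq_some_iff_of_ne hx).1 hn).1
  settled x n hn hb :=
    hT.settled x n ((hT.relaxed_eq_some_iff_of_budget_eq_zero hr hb).1 hn) hb

lemma settled_relaxed_iff : (P.relaxed T u v m).Settled x ↔ T.Settled x :=
  exists_congr fun _ => and_congr_left (hT.relaxed_eq_some_iff_of_budget_eq_zero hr)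

lemma costLevel_relaxed_of_lt {r : ℝ} (hlt : r < m.cost + P.wHat u v) :
    (P.relaxed T u v m).costLevel r = T.costLevel r := by
  ext x
  refine exists_congr fun n => and_congr_left ?_
  rintro rfl
  constructor
  · intro hn
    have hx : x ≠ v := by
      rintro rfl
      obtain rfl : P.childNode u x m = n := by simpa [relaxed_self] using hn
      exact hlt.ne cost_childNode
    exact ((relaxed_eq_some_iff_of_ne hx).1 hn).1
  · intro hn
    rw [relaxed_of_not_inSubtree fun hx => hlt.not_gt (hT.lt_cost_of_inSubtree hr hx hn), hn]

lemma costLevel_ssubset_relaxed :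
    T.costLevel (m.cost + P.wHat u v) ⊂ (P.relaxed T u v m).costLevel (m.cost + P.wHat u v) := by
  refine (Set.ssubset_iff_of_subset ?_).2 ⟨v, ⟨_, relaxed_self, cost_childNode⟩, ?_⟩
  · rintro x ⟨n, hn, hcost⟩
    have hx : ¬ T.InSubtree v x := fun hx => (hT.lt_cost_of_inSubtree hr hx hn).ne' hcost
    exact ⟨n, by rw [relaxed_of_not_inSubtree hx, hn], hcost⟩
  · rintro ⟨n, hn, hcost⟩
    exact (hr.2.2.2.2 n hn).ne' hcost

end Relaxation

lemma extendsTo (hT : P.IsSearchTree α E F T) {T' : SearchTree V}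
    (h : P.ExtendsTo α E T T') : P.IsSearchTree α E F T' ∧ ∀ x, T'.Settled x ↔ T.Settled x := by
  obtain ⟨h, -⟩ := h
  induction h with
  | refl => exact ⟨hT, fun _ => Iff.rfl⟩
  | tail _ hrelax ih =>
    obtain ⟨u, v, m, hr⟩ := hrelax
    exact ⟨ih.1.relaxed hr, fun x => (ih.1.settled_relaxed_iff hr).trans (ih.2 x)⟩

end IsSearchTree

lemma finite_lazyCost_nodup [Finite V] (P : LazyProblem V) :
    (P.lazyCost '' {p | p.Nodup}).Finite := by
  classical
  cases nonempty_fintype V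
  exact (@Set.toFinite _ {p : List V | p.Nodup} (Finite.of_fintype {p : List V // p.Nodup})).image _

/-- An extension step replaces nodes by cheaper ones but may discard arbitrarily many others. It
still makes progress in the lexicographic order of the cost levels, cheapest level first: it adds
a vertex to the level of the new cost and changes no level below. -/
theorem IsSearchTree.exists_extendsTo [Finite V] (hT : P.IsSearchTree α E F T) :
    ∃ T', P.ExtendsTo α E T T' := by
  let costs := P.lazyCost '' {p : List V | p.Nodup}
  have : Finite costs := P.finite_lazyCost_nodup
  let levels (T : SearchTree V) : Lex (costs → (Set V)ᵒᵈ) :=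
    toLex fun r => OrderDual.toDual (T.costLevel r)
  induction T using (InvImage.wf levels wellFounded_lt).induction with
  | h T ih =>
    by_cases hr : ∃ u v m, P.CanRelax α E T u v m
    · obtain ⟨u, v, m, hr⟩ := hr
      obtain ⟨p, hp, hpc⟩ := (hT.relaxed hr).exists_nodup_lazyCost_eq relaxed_self
      have hlt : levels (P.relaxed T u v m) < levels T :=
        ⟨⟨m.cost + P.wHat u v, p, hp, hpc.trans cost_childNode⟩,
          fun _ hlt => congrArg OrderDual.toDual (hT.costLevel_relaxed_of_lt hr hlt),
          hT.costLevel_ssubset_relaxed hr⟩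
      obtain ⟨T', hsteps, hcl⟩ := ih _ hlt (hT.relaxed hr)
      exact ⟨T', .head (.mk T u v m hr) hsteps, hcl⟩
    · push Not at hr
      exact ⟨T, .refl, hr⟩

end LazyProblem

namespace LazyProblem

variable {V : Type*} {P : LazyProblem V} {α : ℕ∞} {E F : Set (V × V)} {T : SearchTree V}
  {h : V → ℝ} {u v x : V} {n : TreeNode V}

lemma w_eq_wHat_iff : P.w u v = (P.wHat u v : EReal) ↔ ¬ P.collides u v := by
  by_cases hcol : P.collides u v <;> simp [w, hcol]

/-! ## Evaluation of an edge -/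

namespace IsSearchTree

section Removal

variable (hT : P.IsSearchTree α E F T) (hn : T v = some n) (hb : 0 < n.b)
include hT hn hb

lemma settled_removeSubtree_iff : (T.removeSubtree v).Settled x ↔ T.Settled x := by
  simp only [SearchTree.Settled, SearchTree.removeSubtree_eq_some_iff]
  exact exists_congr fun k => ⟨fun hk => ⟨hk.1.1, hk.2⟩, fun hk =>
    ⟨⟨hk.1, hT.not_inSubtree_of_settled hn hb ⟨k, hk⟩⟩, hk.2⟩⟩

lemma removeSubtree (u : V) :
    P.IsSearchTree α (E \ {(u, v)}) (insert (u, v) F) (T.removeSubtree v) where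
  edges_subset := Set.sdiff_subset.trans hT.edges_subset
  root := by
    obtain ⟨k, hk, hcost, hk0⟩ := hT.root
    exact ⟨k, SearchTree.removeSubtree_eq_some_iff.2
      ⟨hk, hT.not_inSubtree_of_settled hn hb ⟨k, hk, hk0⟩⟩, hcost, hk0⟩
  rooted x k hk := by
    obtain ⟨hk, hx⟩ := SearchTree.removeSubtree_eq_some_iff.1 hk
    exact (hT.rooted x k hk).congr (fun _ => SearchTree.removeSubtree_of_not_inSubtree) hx
  link y x k hk hp := by
    obtain ⟨hk, hx⟩ := SearchTree.removeSubtree_eq_some_iff.1 hk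
    obtain ⟨m, hm, hl⟩ := hT.link y x k hk hp
    have hy : ¬ T.InSubtree v y := fun hy => hx (hy.tail ⟨k, hk, hp⟩)
    have hxv : x ≠ v := by rintro rfl; exact hx .refl
    exact ⟨m, SearchTree.removeSubtree_eq_some_iff.2 ⟨hm, hy⟩,
      hl.mono ⟨hl.mem, fun he => hxv (Prod.ext_iff.1 he).2⟩ (Set.subset_insert _ _)⟩
  band x k hk := hT.band x k (SearchTree.removeSubtree_eq_some_iff.1 hk).1
  settled x k hk hk0 r hr :=
    hT.settled x k (SearchTree.removeSubtree_eq_some_iff.1 hk).1 hk0 r (hr.mono Set.sdiff_subset)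

end Removal

section Update

variable (hT : P.IsSearchTree α E F T) (hn : T v = some n) (hb : n.b = 1)
include hT hn hb

lemma settled_updateSubtree_iff (r : ℝ) :
    (T.updateSubtree v r).Settled x ↔ x = v ∨ T.Settled x := by
  constructor
  · rintro ⟨_, hk', hk0⟩
    obtain ⟨k, hk, rfl⟩ := SearchTree.updateSubtree_eq_some_iff.1 hk'
    by_cases hx : T.InSubtree v x
    · rw [SearchTree.updatedNode_b_of_inSubtree r hx] at hk0
      by_contra! hne
      have hpos : 0 < k.b := Nat.pos_of_ne_zero fun h0 => hne.2 ⟨k, hk, h0⟩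
      have := hT.budget_lt_of_inSubtree hx hn hk hne.1 hpos
      omega
    · rw [SearchTree.updatedNode_of_not_inSubtree r hx] at hk0
      exact .inr ⟨k, hk, hk0⟩
  · rintro (rfl | ⟨k, hk, hk0⟩)
    · refine ⟨_, SearchTree.updateSubtree_of_eq_some r hn, ?_⟩
      rw [SearchTree.updatedNode_b_of_inSubtree r .refl, hb]
    · exact ⟨_, SearchTree.updateSubtree_of_eq_some r hk,
        Nat.le_zero.1 ((SearchTree.updatedNode_b_le r).trans_eq hk0)⟩

lemma isLink_updatedNode (hp : n.parent = some u) (hcol : ¬ P.collides u v) (r : ℝ) {y : V}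
    {k ky : TreeNode V} (hk : T x = some k) (hky : T y = some ky) (hkp : k.parent = some y)
    (hl : P.IsLink E F y ky x k) :
    P.IsLink E (insert (u, v) F) y (T.updatedNode v r y ky) x (T.updatedNode v r x k) := by
  refine ⟨hl.mem, hl.ne_target, ?_, ?_⟩
  · rw [SearchTree.updatedNode_cost, SearchTree.updatedNode_cost, hl.cost_eq]
  by_cases hy : T.InSubtree v y
  · have hx : T.InSubtree v x := hy.tail ⟨k, hk, hkp⟩
    have := hT.budget_le_of_inSubtree hy hn hky
    have := hl.budget
    rw [SearchTree.updatedNode_b_of_inSubtree r hx, SearchTree.updatedNode_b_of_inSubtree r hy]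
    omega
  rw [SearchTree.updatedNode_of_not_inSubtree r hy]
  by_cases hxv : x = v
  · subst hxv
    obtain rfl : n = k := by simpa [hn] using hk
    obtain rfl : u = y := by simpa [hp] using hkp
    have := hl.budget
    rw [SearchTree.updatedNode_b_of_inSubtree r .refl]
    exact .inr ⟨by omega, by omega, Set.mem_insert _ _, hcol⟩
  · have hx : ¬ T.InSubtree v x := by simp [SearchTree.inSubtree_iff_of_parent hk hkp, hxv, hy]
    rw [SearchTree.updatedNode_of_not_inSubtree r hx]
    exact (hl.mono hl.mem (Set.subset_insert _ _)).budget

lemma updateSubtree (hp : n.parent = some u) (hcol : ¬ P.collides u v)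
    (hcheap : P.IsCheapest E v n.cost) (r : ℝ) :
    P.IsSearchTree α E (insert (u, v) F) (T.updateSubtree v r) where
  edges_subset := hT.edges_subset
  root := by
    obtain ⟨k, hk, hcost, hk0⟩ := hT.root
    exact ⟨_, SearchTree.updateSubtree_of_eq_some r hk,
      (SearchTree.updatedNode_cost r).trans hcost,
      Nat.le_zero.1 ((SearchTree.updatedNode_b_le r).trans_eq hk0)⟩
  rooted x _ hk := by
    obtain ⟨k, hk, -⟩ := SearchTree.updateSubtree_eq_some_iff.1 hk
    rw [SearchTree.InSubtree, SearchTree.isChild_updateSubtree]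
    exact hT.rooted x k hk
  link y x _ hk' hkp := by
    obtain ⟨k, hk, rfl⟩ := SearchTree.updateSubtree_eq_some_iff.1 hk'
    rw [SearchTree.updatedNode_parent] at hkp
    obtain ⟨ky, hky, hl⟩ := hT.link y x k hk hkp
    exact ⟨_, SearchTree.updateSubtree_of_eq_some r hky,
      hT.isLink_updatedNode hn hb hp hcol r hk hky hkp hl⟩
  band x _ hk' := by
    obtain ⟨k, hk, rfl⟩ := SearchTree.updateSubtree_eq_some_iff.1 hk'
    exact (Nat.cast_le.2 (SearchTree.updatedNode_b_le r)).trans (hT.band x k hk)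
  settled x _ hk' hk0 r' hr' := by
    have hx := (hT.settled_updateSubtree_iff hn hb r).1 ⟨_, hk', hk0⟩
    obtain ⟨k, hk, rfl⟩ := SearchTree.updateSubtree_eq_some_iff.1 hk'
    rw [SearchTree.updatedNode_cost]
    rcases hx with rfl | hx
    · obtain rfl : n = k := by simpa [hn] using hk
      exact hcheap.2 hr'
    · exact hT.settled x k hk ((SearchTree.settled_iff hk).1 hx) r' hr'

end Update

/-! ## Popped nodes -/

section Frontier

variable (hT : P.IsSearchTree α E F T) (hcl : ∀ u v m, ¬ P.CanRelax α E T u v m)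
  (htgt : ¬ T.Settled P.target) (hc : P.Consistent h)
include hT hcl htgt hc

/-- Either the band has followed a walk to its end, or the walk leaves the band through a frontier
node, whose key bounds the cost of the walk from below. -/
lemma exists_frontier_of_reaches (hα : 0 < α) {r : ℝ} (hr : P.Reaches E v r) :
    (∃ n, T v = some n ∧ n.cost ≤ r) ∨
      ∃ y n, P.IsFrontier α T y n ∧ n.cost + h y ≤ r + h v := by
  induction hr with
  | source =>
    obtain ⟨n, hn, hcost, -⟩ := hT.root
    exact .inl ⟨n, hn, hcost.le⟩
  | @step u v r _ he ih =>
    have hhu := hc.2 u v (hT.edges_subset he)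
    rcases ih with ⟨m, hm, hle⟩ | ⟨y, n, hy, hle⟩
    · by_cases hfr : P.IsFrontier α T u m
      · exact .inr ⟨u, m, hfr, by linarith⟩
      have hu : u ≠ P.target := by
        rintro rfl
        exact hfr ⟨hm, Nat.pos_of_ne_zero fun h0 => htgt ⟨m, hm, h0⟩, .inr rfl⟩
      have hb : (m.b : ℕ∞) < α := (hT.band u m hm).lt_of_ne fun hbα =>
        hfr ⟨hm, Nat.cast_pos.1 (hbα ▸ hα), .inl hbα⟩
      obtain ⟨n, hn, hcost⟩ := exists_le_of_not_canRelax (hcl u v m) hm hb hu he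
      exact .inl ⟨n, hn, by linarith⟩
    · exact .inr ⟨y, n, hy, by linarith⟩

lemma isCheapest_of_isPopped (hx : P.IsPopped α h T x) (hvx : T.InSubtree v x)
    (hn : T v = some n) : P.IsCheapest E v n.cost := by
  refine ⟨hT.reaches hn, fun r hr => ?_⟩
  obtain ⟨k, ⟨hk, hk0, -⟩, hmin⟩ := hx
  have hα : 0 < α := (Nat.cast_pos.2 hk0).trans_le (hT.band x k hk)
  rcases hT.exists_frontier_of_reaches hcl htgt hc hα hr with ⟨n', hn', hle⟩ | ⟨y, ny, hy, hle⟩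
  · obtain rfl : n = n' := by simpa [hn] using hn'
    exact hle
  · have := hmin y ny hy
    have := hT.key_le_of_inSubtree hc hvx hn hk
    linarith

lemma key_le_of_reaches_target (hx : P.IsPopped α h T x) (hn : T x = some n) {r : ℝ}
    (hr : P.Reaches E P.target r) : n.cost + h x ≤ r := by
  obtain ⟨k, ⟨hk, hk0, -⟩, hmin⟩ := hx
  obtain rfl : n = k := by simpa [hn] using hk
  have hα : 0 < α := (Nat.cast_pos.2 hk0).trans_le (hT.band x n hk)
  have hh := hc.1
  rcases hT.exists_frontier_of_reaches hcl htgt hc hα hr with ⟨k, hk, hle⟩ | ⟨y, ny, hy, hle⟩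
  · have hkfr : P.IsFrontier α T P.target k :=
      ⟨hk, Nat.pos_of_ne_zero fun h0 => htgt ⟨k, hk, h0⟩, .inr rfl⟩
    have := hmin _ k hkfr
    linarith
  · have := hmin y ny hy
    linarith

end Frontier

lemma exists_firstLazyEdge (hT : P.IsSearchTree α E F T) (hn : T x = some n) (hb : 0 < n.b) :
    ∃ u v, IsFirstLazyEdge T x u v := by
  refine hT.induction (p := fun x n => 0 < n.b → ∃ u v, IsFirstLazyEdge T x u v) ?_ ?_ hn hb
  · exact fun n _ _ hb hpos => absurd hb hpos.ne'
  · intro y k x n _ hn hp hl ih hpos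
    rcases Nat.eq_zero_or_pos k.b with hk0 | hkpos
    · have := hl.budget
      exact ⟨y, x, .refl, n, hn, hp, by omega⟩
    · obtain ⟨u, v, hvy, hv⟩ := ih hkpos
      exact ⟨u, v, hvy.tail ⟨n, hn, hp⟩, hv⟩

end IsSearchTree

end LazyProblem

/-! ## The invariant of a run -/

namespace LazyProblem

variable {V : Type*} {P : LazyProblem V} {α : ℕ∞} {h : V → ℝ} {s s' : State V} {u v x : V}

/-- `(u, v)` is an edge that the next iteration from the state `s` may evaluate. -/
def IsSelected (P : LazyProblem V) (α : ℕ∞) (h : V → ℝ) (s : State V) (u v : V) : Prop :=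
  ¬ s.found ∧ ∃ x, P.IsPopped α h s.tree x ∧ IsFirstLazyEdge s.tree x u v

/-- The invariant of the states of a run. The last two fields say that the target is not settled
before a path is returned (unless it is the source, and then there is no frontier node) and that
no frontier node has a smaller key than the returned path. -/
structure StateInvariant (P : LazyProblem V) (α : ℕ∞) (h : V → ℝ) (s : State V) : Prop where
  tree : P.IsSearchTree α s.edges s.evaluated s.tree
  closed : ∀ u v m, ¬ P.CanRelax α s.edges s.tree u v m
  edges_eq : s.edges = P.edgeSet \ {e ∈ s.evaluated | P.collides e.1 e.2}
  tail_settled : ∀ u v, (u, v) ∈ s.evaluated → s.tree.Settled u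
  head_settled : ∀ u v, (u, v) ∈ s.evaluated → ¬ P.collides u v → s.tree.Settled v
  target_not_settled : ¬ s.found → ∀ y k, P.IsFrontier α s.tree y k → ¬ s.tree.Settled P.target
  found : s.found → ∃ n, s.tree P.target = some n ∧ n.b = 0 ∧
    ∀ y k, P.IsFrontier α s.tree y k → n.cost ≤ k.cost + h y

lemma Step.exists_isSelected (hstep : P.Step α h s s') :
    ∃ u v, P.IsSelected α h s u v ∧ s'.evaluated = insert (u, v) s.evaluated := by
  rcases hstep with ⟨x, u, v, hs, hx, he, -, -⟩ | ⟨x, u, v, -, hs, hx, he, -, -, -⟩ |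
    ⟨x, u, v, -, hs, hx, he, -, -⟩ <;> exact ⟨u, v, ⟨hs, x, hx, he⟩, rfl⟩

section Initial

variable (P α)

lemma isSearchTree_rootTree : P.IsSearchTree α P.edgeSet ∅ P.rootTree where
  edges_subset := subset_rfl
  root := ⟨⟨none, 0, 0, 0⟩, if_pos rfl, add_zero 0, rfl⟩
  rooted v n hn := by
    obtain ⟨rfl, -⟩ : v = P.source ∧ _ := by simpa [rootTree] using hn
    exact .refl
  link u v n hn hp := by
    obtain ⟨-, rfl⟩ : v = P.source ∧ _ := by simpa [rootTree] using hn
    simp at hp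
  band v n hn := by
    obtain ⟨-, rfl⟩ : v = P.source ∧ _ := by simpa [rootTree] using hn
    simp
  settled v n hn _ r hr := by
    obtain ⟨-, rfl⟩ : v = P.source ∧ _ := by simpa [rootTree] using hn
    simpa [TreeNode.cost] using hr.nonneg subset_rfl

lemma settled_rootTree_iff : P.rootTree.Settled x ↔ x = P.source := by
  by_cases hx : x = P.source <;> simp [SearchTree.Settled, rootTree, hx]

variable {P α}

lemma ExtendsTo.eq_rootTree {E : Set (V × V)} {T : SearchTree V} (hst : P.target = P.source)
    (hT : P.ExtendsTo α E P.rootTree T) : T = P.rootTree := by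
  rcases Relation.ReflTransGen.cases_head hT.1 with hT | ⟨_, ⟨u, _, m, hu, -, hne, -⟩, -⟩
  · exact hT.symm
  · obtain ⟨rfl, -⟩ : u = P.source ∧ _ := by simpa [rootTree] using hu
    exact absurd hst.symm hne

lemma IsInitial.stateInvariant (hs : P.IsInitial α s) (h : V → ℝ) :
    P.StateInvariant α h s := by
  obtain ⟨hE, hT, hF, hnf⟩ := hs
  obtain ⟨htree, hsettled⟩ := (P.isSearchTree_rootTree α).extendsTo hT
  refine ⟨by rwa [hE, hF], by simpa only [hE] using hT.2, by simp [hE, hF], by simp [hF],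
    by simp [hF], fun _ y k ⟨hk, hb, _⟩ htgt => ?_, fun hf => absurd hf hnf⟩
  rw [hT.eq_rootTree (P.settled_rootTree_iff.1 ((hsettled _).1 htgt))] at hk
  obtain ⟨-, rfl⟩ : y = P.source ∧ _ := by simpa [rootTree] using hk
  exact hb.ne rfl

end Initial

namespace StateInvariant

section Selected

variable (hs : P.StateInvariant α h s)
include hs

lemma mem_edges_iff : (u, v) ∈ s.edges ↔
    (u, v) ∈ P.edgeSet ∧ ((u, v) ∈ s.evaluated → ¬ P.collides u v) := by
  simp [hs.edges_eq]

lemma target_not_settled_of_isPopped (hnf : ¬ s.found) (hx : P.IsPopped α h s.tree x) :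
    ¬ s.tree.Settled P.target := by
  obtain ⟨n, hn, -⟩ := hx
  exact hs.target_not_settled hnf x n hn

lemma settled_of_isFirstLazyEdge (he : IsFirstLazyEdge s.tree x u v) : s.tree.Settled u := by
  obtain ⟨-, n, hn, hp, hb⟩ := he
  obtain ⟨m, hm, hl⟩ := hs.tree.link u v n hn hp
  have := hl.budget
  exact ⟨m, hm, by omega⟩

end Selected

lemma tail_settled_insert (hs : P.StateInvariant α h s) {T : SearchTree V}
    (hmono : ∀ x, s.tree.Settled x → T.Settled x) (hu : s.tree.Settled u) (a b : V)
    (hab : (a, b) ∈ insert (u, v) s.evaluated) : T.Settled a := by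
  rcases hab with hab | hab
  · obtain ⟨rfl, -⟩ := Prod.ext_iff.1 hab
    exact hmono _ hu
  · exact hmono _ (hs.tail_settled a b hab)

lemma head_settled_insert (hs : P.StateInvariant α h s) {T : SearchTree V}
    (hmono : ∀ x, s.tree.Settled x → T.Settled x) (hv : ¬ P.collides u v → T.Settled v) (a b : V)
    (hab : (a, b) ∈ insert (u, v) s.evaluated) (hcol : ¬ P.collides a b) : T.Settled b := by
  rcases hab with hab | hab
  · obtain ⟨rfl, rfl⟩ := Prod.ext_iff.1 hab
    exact hv hcol
  · exact hmono _ (hs.head_settled a b hab hcol)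

/-- The part of the induction step shared by the two kinds of iterations that extend the band: `T`
is the tree before the extension. -/
lemma of_extendsTo (hs : P.StateInvariant α h s) {E : Set (V × V)} {T T' : SearchTree V}
    (hT : P.IsSearchTree α E (insert (u, v) s.evaluated) T)
    (hE : E = P.edgeSet \ {e ∈ insert (u, v) s.evaluated | P.collides e.1 e.2})
    (hmono : ∀ x, s.tree.Settled x → T.Settled x) (hu : s.tree.Settled u)
    (hv : ¬ P.collides u v → T.Settled v) (htgt : ¬ T.Settled P.target)
    (hext : P.ExtendsTo α E T T') :
    P.StateInvariant α h ⟨E, T', insert (u, v) s.evaluated, False⟩ := by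
  obtain ⟨hT', hsettled⟩ := hT.extendsTo hext
  have hmono' x (hx : s.tree.Settled x) : T'.Settled x := (hsettled x).2 (hmono x hx)
  exact ⟨hT', hext.2, hE, hs.tail_settled_insert hmono' hu,
    hs.head_settled_insert hmono' fun hcol => (hsettled v).2 (hv hcol),
    fun _ _ _ _ ht => htgt ((hsettled _).1 ht), False.elim⟩

lemma edges_eq_of_not_collides (hs : P.StateInvariant α h s) (hcol : ¬ P.collides u v) :
    s.edges = P.edgeSet \ {e ∈ insert (u, v) s.evaluated | P.collides e.1 e.2} := by
  rw [hs.edges_eq]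
  ext ⟨a, b⟩
  simp only [edgeSet, Set.mem_sdiff, Set.mem_ofPred_eq, Set.mem_insert_iff, Prod.mk.injEq]
  grind

lemma edges_sdiff_eq_of_collides (hs : P.StateInvariant α h s) (hcol : P.collides u v) :
    s.edges \ {(u, v)} =
      P.edgeSet \ {e ∈ insert (u, v) s.evaluated | P.collides e.1 e.2} := by
  rw [hs.edges_eq]
  ext ⟨a, b⟩
  simp only [edgeSet, Set.mem_sdiff, Set.mem_ofPred_eq, Set.mem_insert_iff, Set.mem_singleton_iff,
    Prod.mk.injEq]
  grind

section Steps

variable (hs : P.StateInvariant α h s) (hc : P.Consistent h) (hnf : ¬ s.found)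
  (hx : P.IsPopped α h s.tree x) (he : IsFirstLazyEdge s.tree x u v)
include hs hnf hx he

include hc in
lemma isSearchTree_updateSubtree (hcol : ¬ P.collides u v) (r : ℝ) :
    P.IsSearchTree α s.edges (insert (u, v) s.evaluated) (s.tree.updateSubtree v r) := by
  obtain ⟨hvx, n, hn, hp, hb⟩ := he
  exact hs.tree.updateSubtree hn hb hp hcol (hs.tree.isCheapest_of_isPopped hs.closed
    (hs.target_not_settled_of_isPopped hnf hx) hc hx hvx hn) r

include hc in
lemma free (hcol : ¬ P.collides u v) (hv : v ≠ P.target) {r : ℝ} {T' : SearchTree V}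
    (hext : P.ExtendsTo α s.edges (s.tree.updateSubtree v r) T') :
    P.StateInvariant α h ⟨s.edges, T', insert (u, v) s.evaluated, False⟩ := by
  obtain ⟨-, n, hn, -, hb⟩ := id he
  have hsettled {y} := hs.tree.settled_updateSubtree_iff hn hb r (x := y)
  refine hs.of_extendsTo (hs.isSearchTree_updateSubtree hc hnf hx he hcol r)
    (hs.edges_eq_of_not_collides hcol) (fun y hy => hsettled.2 (.inr hy))
    (hs.settled_of_isFirstLazyEdge he) (fun _ => hsettled.2 (.inl rfl)) (fun ht => ?_) hext
  exact (hsettled.1 ht).elim hv.symm (hs.target_not_settled_of_isPopped hnf hx)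

lemma collision (hcol : P.collides u v) {T' : SearchTree V}
    (hext : P.ExtendsTo α (s.edges \ {(u, v)}) (s.tree.removeSubtree v) T') :
    P.StateInvariant α h ⟨s.edges \ {(u, v)}, T', insert (u, v) s.evaluated, False⟩ := by
  obtain ⟨-, n, hn, -, hb⟩ := id he
  have hb : 0 < n.b := hb ▸ Nat.one_pos
  have hsettled {y} := hs.tree.settled_removeSubtree_iff hn hb (x := y)
  exact hs.of_extendsTo (hs.tree.removeSubtree hn hb u) (hs.edges_sdiff_eq_of_collides hcol)
    (fun _ => hsettled.2) (hs.settled_of_isFirstLazyEdge he) (fun hfree => absurd hcol hfree)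
    (fun ht => hs.target_not_settled_of_isPopped hnf hx (hsettled.1 ht)) hext

end Steps

section Reach

variable (hs : P.StateInvariant α h s)
include hs

lemma updateSubtree_target_of_ne (r : ℝ) (hx : x ≠ P.target) :
    s.tree.updateSubtree P.target r x = s.tree x := by
  rw [SearchTree.updateSubtree, if_neg fun h => hx (hs.tree.eq_of_inSubtree_target h)]

lemma not_canRelax_updateSubtree_target (r : ℝ) (m : TreeNode V) :
    ¬ P.CanRelax α s.edges (s.tree.updateSubtree P.target r) u v m := by
  rintro ⟨hm, hb, hu, he, hlt⟩
  rw [hs.updateSubtree_target_of_ne r hu] at hm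
  refine hs.closed u v m ⟨hm, hb, hu, he, fun n hn => ?_⟩
  exact (hlt _ (SearchTree.updateSubtree_of_eq_some r hn)).trans_eq (SearchTree.updatedNode_cost r)

/-- The path to the target is returned when the target is popped, so its cost is the minimal key. -/
lemma exists_node_target_updateSubtree (hc : P.Consistent h)
    (hx : P.IsPopped α h s.tree P.target)
    (he : IsFirstLazyEdge s.tree P.target u P.target) (r : ℝ) :
    ∃ n, s.tree.updateSubtree P.target r P.target = some n ∧ n.b = 0 ∧
      ∀ y k, P.IsFrontier α (s.tree.updateSubtree P.target r) y k → n.cost ≤ k.cost + h y := by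
  obtain ⟨-, n, hn, -, hb⟩ := he
  obtain ⟨n', ⟨hn', -⟩, hmin⟩ := hx
  obtain rfl : n = n' := by simpa [hn] using hn'
  have hn₁ := SearchTree.updateSubtree_of_eq_some (v := P.target) r hn
  have hb₁ : (s.tree.updatedNode P.target r P.target n).b = 0 := by
    rw [SearchTree.updatedNode_b_of_inSubtree r .refl, hb]
  refine ⟨_, hn₁, hb₁, fun y k ⟨hk, hk0, hfr⟩ => ?_⟩
  have hy : y ≠ P.target := by
    rintro rfl
    obtain rfl := Option.some_injective _ (hn₁.symm.trans hk)
    exact hk0.ne' hb₁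
  rw [hs.updateSubtree_target_of_ne r hy] at hk
  simpa [SearchTree.updatedNode_cost, hc.1] using hmin y k ⟨hk, hk0, hfr⟩

lemma reach (hc : P.Consistent h) (hnf : ¬ s.found) (hx : P.IsPopped α h s.tree x)
    (he : IsFirstLazyEdge s.tree x u P.target) (hcol : ¬ P.collides u P.target) (r : ℝ) :
    P.StateInvariant α h
      ⟨s.edges, s.tree.updateSubtree P.target r, insert (u, P.target) s.evaluated, True⟩ := by
  obtain rfl := hs.tree.eq_of_inSubtree_target he.1
  obtain ⟨-, n, hn, -, hb⟩ := id he
  have hsettled {y} := hs.tree.settled_updateSubtree_iff hn hb r (x := y)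
  have hmono y (hy : s.tree.Settled y) : (s.tree.updateSubtree P.target r).Settled y :=
    hsettled.2 (.inr hy)
  exact ⟨hs.isSearchTree_updateSubtree hc hnf hx he hcol r,
    fun _ _ m => hs.not_canRelax_updateSubtree_target r m, hs.edges_eq_of_not_collides hcol,
    hs.tail_settled_insert hmono (hs.settled_of_isFirstLazyEdge he),
    hs.head_settled_insert hmono fun _ => hsettled.2 (.inl rfl), absurd trivial,
    fun _ => hs.exists_node_target_updateSubtree hc hx he r⟩

end Reach

lemma step (hs : P.StateInvariant α h s) (hc : P.Consistent h) (hstep : P.Step α h s s') :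
    P.StateInvariant α h s' := by
  rcases hstep with ⟨x, u, v, hnf, hx, he, hw, rfl⟩ | ⟨x, u, v, T', hnf, hx, he, hw, hv, hext⟩ |
    ⟨x, u, v, T', hnf, hx, he, hw, hext⟩
  · exact hs.reach hc hnf hx he (w_eq_wHat_iff.1 hw) _
  · exact hs.free hc hnf hx he (w_eq_wHat_iff.1 hw) hv hext
  · exact hs.collision hnf hx he (not_not.1 fun hcol => hw (w_eq_wHat_iff.2 hcol)) hext

lemma of_reflTransGen (hs : P.StateInvariant α h s) (hc : P.Consistent h)
    (hrun : Relation.ReflTransGen (P.Step α h) s s') : P.StateInvariant α h s' := by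
  induction hrun with
  | refl => exact hs
  | tail _ hstep ih => exact ih.step hc hstep

end StateInvariant

end LazyProblem

/-! ## Termination -/

namespace LazyProblem

variable {V : Type*} [Finite V] {P : LazyProblem V} {α : ℕ∞} {h : V → ℝ} {s s' : State V}

/-- The number of remaining edges plus the number of vertices that are not settled. Every iteration
removes an edge or settles a vertex. -/
noncomputable def potential (s : State V) : ℕ :=
  s.edges.ncard + {x | ¬ s.tree.Settled x}.ncard

lemma potential_lt_of_settled_iff {E F F' : Set (V × V)} {T T' : SearchTree V} {f f' : Prop}
    {v : V} (hv : ¬ T.Settled v) (h : ∀ x, T'.Settled x ↔ x = v ∨ T.Settled x) :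
    potential ⟨E, T', F', f'⟩ < potential ⟨E, T, F, f⟩ := by
  refine Nat.add_lt_add_left (Set.ncard_lt_ncard ?_) _
  refine (Set.ssubset_iff_of_subset fun x (hx : ¬ T'.Settled x) hT => hx ((h x).2 (.inr hT))).2
    ⟨v, hv, ?_⟩
  exact fun hv' => hv' ((h v).2 (.inl rfl))

namespace StateInvariant

lemma potential_lt (hs : P.StateInvariant α h s) (hc : P.Consistent h)
    (hstep : P.Step α h s s') : potential s' < potential s := by
  rcases hstep with ⟨x, u, v, hnf, hx, he, hw, -⟩ | ⟨x, u, v, T', hnf, hx, he, hw, -, hext⟩ |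
    ⟨x, u, v, T', hnf, hx, he, hw, hext⟩
  all_goals
    obtain ⟨-, n, hn, hp, hb⟩ := id he
    have hv : ¬ s.tree.Settled v := by simp [SearchTree.settled_iff hn, hb]
  · exact potential_lt_of_settled_iff hv fun _ => hs.tree.settled_updateSubtree_iff hn hb _
  · have htree := hs.isSearchTree_updateSubtree hc hnf hx he (w_eq_wHat_iff.1 hw) (P.wHat u v)
    exact potential_lt_of_settled_iff hv fun y =>
      ((htree.extendsTo hext).2 y).trans (hs.tree.settled_updateSubtree_iff hn hb _)
  · have hb : 0 < n.b := hb ▸ Nat.one_pos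
    have hsettled (y) : T'.Settled y ↔ s.tree.Settled y :=
      (((hs.tree.removeSubtree hn hb u).extendsTo hext).2 y).trans
        (hs.tree.settled_removeSubtree_iff hn hb)
    obtain ⟨m, -, hl⟩ := hs.tree.link u v n hn hp
    simp only [potential, hsettled]
    exact Nat.add_lt_add_right (Set.ncard_sdiff_singleton_lt_of_mem hl.mem) _

end StateInvariant

lemma exists_isPopped (h : V → ℝ) {T : SearchTree V} {y : V} {k : TreeNode V}
    (hy : P.IsFrontier α T y k) : ∃ x, P.IsPopped α h T x := by
  choose node hnode using fun y : {y // ∃ k, P.IsFrontier α T y k} => y.2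
  have : Nonempty {y // ∃ k, P.IsFrontier α T y k} := ⟨y, k, hy⟩
  obtain ⟨x, hmin⟩ := Finite.exists_min fun y => (node y).cost + h y
  refine ⟨x, node x, hnode x, fun y k hy => ?_⟩
  have hk : node ⟨y, k, hy⟩ = k :=
    Option.some_injective _ ((hnode ⟨y, k, hy⟩).1.symm.trans hy.1)
  exact (hmin ⟨y, k, hy⟩).trans_eq (by rw [hk])

namespace StateInvariant

lemma exists_step (hs : P.StateInvariant α h s) (hc : P.Consistent h)
    (hh : ¬ P.IsHalted α s) : ∃ s', P.Step α h s s' := by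
  obtain ⟨hnf, y, k, hy⟩ : ¬ s.found ∧ ∃ y k, P.IsFrontier α s.tree y k := by
    simpa [IsHalted] using hh
  obtain ⟨x, hx⟩ := exists_isPopped h hy
  obtain ⟨n, ⟨hn, hb, -⟩, -⟩ := id hx
  obtain ⟨u, v, he⟩ := hs.tree.exists_firstLazyEdge hn hb
  obtain ⟨-, k, hk, -, hk1⟩ := id he
  by_cases hw : P.w u v = (P.wHat u v : EReal)
  · by_cases hv : v = P.target
    · exact ⟨_, .reach s x u v hnf hx he hw hv⟩
    · obtain ⟨T', hext⟩ := (hs.isSearchTree_updateSubtree hc hnf hx he (w_eq_wHat_iff.1 hw)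
        (P.wHat u v)).exists_extendsTo
      exact ⟨_, .free s x u v T' hnf hx he hw hv hext⟩
  · obtain ⟨T', hext⟩ := (hs.tree.removeSubtree hk (hk1 ▸ Nat.one_pos) u).exists_extendsTo
    exact ⟨_, .collision s x u v T' hnf hx he hw hext⟩

lemma exists_isHalted (hs : P.StateInvariant α h s) (hc : P.Consistent h) :
    ∃ s', Relation.ReflTransGen (P.Step α h) s s' ∧ P.IsHalted α s' := by
  induction s using (measure potential).wf.induction with
  | h s ih =>
    by_cases hh : P.IsHalted α s
    · exact ⟨s, .refl, hh⟩
    · obtain ⟨s', hstep⟩ := hs.exists_step hc hh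
      obtain ⟨s'', hrun, hh'⟩ := ih s' (hs.potential_lt hc hstep) (hs.step hc hstep)
      exact ⟨s'', .head hstep hrun, hh'⟩

end StateInvariant

theorem exists_isEvaluatedSet (P : LazyProblem V) (α : ℕ∞) (hc : P.Consistent h) :
    ∃ E, P.IsEvaluatedSet α h E := by
  obtain ⟨T, hT⟩ := (P.isSearchTree_rootTree α).exists_extendsTo
  have hinit : P.IsInitial α ⟨P.edgeSet, T, ∅, False⟩ := ⟨rfl, hT, rfl, id⟩
  obtain ⟨s, hrun, hh⟩ := (hinit.stateInvariant h).exists_isHalted hc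
  exact ⟨s.evaluated, _, s, hinit, hrun, hh, rfl⟩

end LazyProblem

/-! ## Comparison of two runs -/

namespace LazyProblem

variable {V : Type*} {P : LazyProblem V} {α : ℕ∞} {u v x : V}

/-- Without ties a vertex has only one parent through which it is reached at minimal cost. -/
lemma IsSearchTree.agreeAt_child {E₁ E₂ F₁ F₂ : Set (V × V)} {T₁ T₂ : SearchTree V}
    {n : TreeNode V} (hT₁ : P.IsSearchTree α E₁ F₁ T₁) (hT₂ : P.IsSearchTree α E₂ F₂ T₂)
    (hties : P.NoTies) (hE : E₂ ⊆ E₁) (hcl : ∀ u v m, ¬ P.CanRelax α E₂ T₂ u v m)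
    (hu : SearchTree.AgreeAt T₁ T₂ u) (hn : T₁ v = some n) (hp : n.parent = some u)
    (hb : 0 < n.b) (hcheap : P.IsCheapest E₁ v n.cost) (he : (u, v) ∈ E₂) (hF : (u, v) ∉ F₂) :
    SearchTree.AgreeAt T₁ T₂ v := by
  obtain ⟨m₁, m₂, hm₁, hm₂, hmcost, hmb⟩ := hu
  obtain ⟨m, hm, hl⟩ := hT₁.link u v n hn hp
  obtain rfl : m₁ = m := by simpa [hm₁] using hm
  have hnb : n.b = m₁.b + 1 := by
    have := hl.budget
    omega
  have hmα : (m₂.b : ℕ∞) < α :=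
    (Nat.cast_lt.2 (by omega : m₂.b < n.b)).trans_le (hT₁.band v n hn)
  obtain ⟨k, hk, hkle⟩ := exists_le_of_not_canRelax (hcl u v m₂) hm₂ hmα hl.ne_target he
  have hkcost : k.cost = n.cost :=
    le_antisymm (by rwa [hl.cost_eq, ← hmcost]) (hcheap.2 ((hT₂.reaches hk).mono hE))
  have hpos : 0 < k.cost := by
    have := hT₁.cost_nonneg hm₁
    have := hT₁.wHat_pos hl.mem
    have := hl.cost_eq
    linarith
  obtain ⟨u', m', -, hm', hl'⟩ := hT₂.exists_parent hk (hT₂.ne_source_of_cost_pos hk hpos)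
  obtain rfl : u = u' := hties.eq_of_isCheapest hT₁.edges_subset (hT₁.reaches hm₁)
    ((hT₂.reaches hm').mono hE) hl.mem (hE hl'.mem) (hl.cost_eq ▸ hcheap)
    (hl'.cost_eq ▸ hkcost ▸ hcheap)
  obtain rfl : m₂ = m' := by simpa [hm₂] using hm'
  have hkb : k.b = m₂.b + 1 := hl'.budget.resolve_right fun h => hF h.2.2.1
  exact ⟨n, k, hn, hk, hkcost, by omega⟩

namespace StateInvariant

variable {h₁ h₂ : V → ℝ} {s₁ s₂ : State V} (hs₁ : P.StateInvariant α h₁ s₁)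
  (hs₂ : P.StateInvariant α h₂ s₂) (hF : s₁.evaluated ⊆ s₂.evaluated)
include hs₁ hs₂ hF

lemma edges_subset_of_evaluated_subset : s₂.edges ⊆ s₁.edges := fun _ he =>
  hs₁.mem_edges_iff.2 ((hs₂.mem_edges_iff.1 he).imp_right fun hcol hf => hcol (hF hf))

lemma agreeAt_of_settled (hu : s₁.tree.Settled u) : SearchTree.AgreeAt s₁.tree s₂.tree u := by
  obtain ⟨n, hn, hb⟩ := hu
  refine hs₁.tree.induction
    (p := fun u n => n.b = 0 → SearchTree.AgreeAt s₁.tree s₂.tree u) ?_ ?_ hn hb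
  · intro n hn hcost hb _
    obtain ⟨k, hk, hkcost, hkb⟩ := hs₂.tree.root
    exact ⟨n, k, hn, hk, hkcost.trans hcost.symm, hkb.trans hb.symm⟩
  · intro y m v n hm hn _ hl ih hb
    obtain ⟨-, hm0, hf, hcol⟩ := hl.budget.resolve_left (by omega)
    obtain ⟨m', m₂, hm', hm₂, hmcost, -⟩ := ih hm0
    obtain rfl : m = m' := by simpa [hm] using hm'
    obtain ⟨k, hk, hkb⟩ := hs₂.head_settled y v (hF hf) hcol
    have he : (y, v) ∈ s₂.edges :=
      hs₂.mem_edges_iff.2 ⟨(hs₁.mem_edges_iff.1 hl.mem).1, fun _ => hcol⟩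
    have hle : k.cost ≤ n.cost := by
      rw [hl.cost_eq, ← hmcost]
      exact hs₂.tree.settled v k hk hkb _ (.step (hs₂.tree.reaches hm₂) he)
    have hge : n.cost ≤ k.cost := hs₁.tree.settled v n hn hb _
      ((hs₂.tree.reaches hk).mono (hs₁.edges_subset_of_evaluated_subset hs₂ hF))
    exact ⟨n, k, hn, hk, hle.antisymm hge, by omega⟩

section Popped

variable (hties : P.NoTies) (hc₁ : P.Consistent h₁) (hnf : ¬ s₁.found)
  (hx : P.IsPopped α h₁ s₁.tree x)
include hties hc₁ hnf hx

lemma agreeAt_child_of_isPopped {n : TreeNode V} (hu : SearchTree.AgreeAt s₁.tree s₂.tree u)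
    (hn : s₁.tree v = some n) (hp : n.parent = some u) (hb : 0 < n.b)
    (hvx : s₁.tree.InSubtree v x) (huv : (u, v) ∉ s₂.evaluated) :
    SearchTree.AgreeAt s₁.tree s₂.tree v := by
  have hcheap : P.IsCheapest s₁.edges v n.cost := hs₁.tree.isCheapest_of_isPopped hs₁.closed
    (hs₁.target_not_settled_of_isPopped hnf hx) hc₁ hx hvx hn
  have he : (u, v) ∈ s₂.edges := by
    obtain ⟨m, -, hl⟩ := hs₁.tree.link u v n hn hp
    exact hs₂.mem_edges_iff.2 ⟨hs₁.tree.edges_subset hl.mem, fun hf => absurd hf huv⟩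
  exact hs₁.tree.agreeAt_child hs₂.tree hties (hs₁.edges_subset_of_evaluated_subset hs₂ hF)
    hs₂.closed hu hn hp hb hcheap he huv

/-- The edges of the lazy tail below `v` are not evaluated in the second run either: as long as
`v` is not settled, no edge out of a descendant of `v` has been evaluated. -/
lemma agreeAt_of_isPopped (he : IsFirstLazyEdge s₁.tree x u v) (huv : (u, v) ∉ s₂.evaluated) :
    SearchTree.AgreeAt s₁.tree s₂.tree x := by
  obtain ⟨hvx, nv, hnv, hpv, hbv⟩ := id he
  suffices agree_on_tail : ∀ y, s₁.tree.InSubtree v y → s₁.tree.InSubtree y x →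
      SearchTree.AgreeAt s₁.tree s₂.tree y from agree_on_tail x hvx .refl
  intro y hvy hyx
  induction hvy with
  | refl =>
    exact hs₁.agreeAt_child_of_isPopped hs₂ hF hties hc₁ hnf hx
      (hs₁.agreeAt_of_settled hs₂ hF (hs₁.settled_of_isFirstLazyEdge he)) hnv hpv
      (hbv ▸ Nat.one_pos) hyx huv
  | @tail z y hvz hzy ih =>
    have agree_z := ih (.head hzy hyx)
    obtain ⟨m, m₂, hm, hm₂, -, hmb⟩ := id agree_z
    obtain ⟨n, hn, hp⟩ := id hzy
    have hbm := hs₁.tree.budget_le_of_inSubtree hvz hnv hm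
    have hbn := hs₁.tree.budget_le_of_inSubtree (hvz.tail hzy) hnv hn
    refine hs₁.agreeAt_child_of_isPopped hs₂ hF hties hc₁ hnf hx agree_z hn hp (by omega) hyx
      fun hf => ?_
    have hm₂0 := (SearchTree.settled_iff hm₂).1 (hs₂.tail_settled z y hf)
    omega

end Popped

/-- Otherwise the popped node of the first run would be a frontier node of the second one, with a
key smaller than the cost of the returned path. -/
lemma mem_evaluated (hties : P.NoTies) (hc₁ : P.Consistent h₁)
    (hdom : ∀ v, v ≠ P.target → h₂ v < h₁ v) (hh : P.IsHalted α s₂)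
    (huv : P.IsSelected α h₁ s₁ u v) : (u, v) ∈ s₂.evaluated := by
  by_contra hnot
  obtain ⟨hnf, x, hx, he⟩ := huv
  obtain ⟨n, k, hn, hk, hcost, hb⟩ := hs₁.agreeAt_of_isPopped hs₂ hF hties hc₁ hnf hx he hnot
  obtain ⟨n', ⟨hn', hpos, hfr⟩, -⟩ := id hx
  obtain rfl : n = n' := by simpa [hn] using hn'
  have hxfr : P.IsFrontier α s₂.tree x k := ⟨hk, hb ▸ hpos, hb ▸ hfr⟩
  rcases hh with hfound | hempty
  · obtain ⟨t, ht, ht0, hmin⟩ := hs₂.found hfound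
    have hxt : x ≠ P.target := by
      rintro rfl
      obtain rfl : t = k := by simpa [ht] using hk
      omega
    have hkey : n.cost + h₁ x ≤ t.cost :=
      hs₁.tree.key_le_of_reaches_target hs₁.closed (hs₁.target_not_settled_of_isPopped hnf hx)
        hc₁ hx hn ((hs₂.tree.reaches ht).mono (hs₁.edges_subset_of_evaluated_subset hs₂ hF))
    have := hmin x k hxfr
    have := hdom x hxt
    linarith
  · exact hempty x k hxfr

end StateInvariant

theorem IsEvaluatedSet.subset {h₁ h₂ : V → ℝ} {E₁ E₂ : Set (V × V)}
    (hE₁ : P.IsEvaluatedSet α h₁ E₁) (hE₂ : P.IsEvaluatedSet α h₂ E₂) (hties : P.NoTies)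
    (hc₁ : P.Consistent h₁) (hc₂ : P.Consistent h₂)
    (hdom : ∀ v, v ≠ P.target → h₂ v < h₁ v) : E₁ ⊆ E₂ := by
  obtain ⟨s₀, s₁, hinit₁, hrun₁, -, rfl⟩ := hE₁
  obtain ⟨_, s₂, hinit₂, hrun₂, hhalt₂, rfl⟩ := hE₂
  have hs₂ := (hinit₂.stateInvariant h₂).of_reflTransGen hc₂ hrun₂
  induction hrun₁ with
  | refl => simp [hinit₁.2.2.1]
  | tail hrun hstep ih =>
    have hs := (hinit₁.stateInvariant h₁).of_reflTransGen hc₁ hrun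
    obtain ⟨u, v, huv, heq⟩ := hstep.exists_isSelected
    rw [heq]
    exact Set.insert_subset (hs.mem_evaluated hs₂ ih hties hc₁ hdom hhalt₂ huv) ih

end LazyProblem

theorem mainTheorem4 {V : Type*} [Finite V] (P : LazyProblem V) (hties : P.NoTies)
    (α : ℕ∞) (hα : 1 ≤ α) (h₁ h₂ : V → ℝ)
    (hc₁ : P.Consistent h₁) (hc₂ : P.Consistent h₂)
    (hadm : ∀ v, v ≠ P.target → (h₁ v : EReal) ≤ P.optHeuristic v)
    (hdom : ∀ v, v ≠ P.target → h₂ v < h₁ v) :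
    (∃ E₁, P.IsEvaluatedSet α h₁ E₁) ∧ (∃ E₂, P.IsEvaluatedSet α h₂ E₂) ∧
      ∀ E₁ E₂ : Set (V × V),
        P.IsEvaluatedSet α h₁ E₁ → P.IsEvaluatedSet α h₂ E₂ → E₁ ⊆ E₂ := by
  exact ⟨P.exists_isEvaluatedSet α hc₁, P.exists_isEvaluatedSet α hc₂,
    fun _ _ hE₁ hE₂ => hE₁.subset hE₂ hties hc₁ hc₂ hdom⟩
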